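/- There are absolute constants $C>0$ and $\tilde c>0$ such that the following two statements hold. Here a matrix $A\in\mathbb{C}^{m\times n}$ is said to recover all $s$-sparse vectors if, for every $x\in\mathbb{C}^n$ with at most $s$ non-zero entries, $x$ is the unique minimizer of $\|z\|_{\ell_1}=\sum_{k=1}^n|z_k|$ over all $z\in\mathbb{C}^n$ with $Az=Ax$. (This covers in particular all real $s$-sparse vectors $x\in\mathbb{R}^n$.) (1) Let $n\ge 5$ be prime, let $\omega_n=\exp(2\pi i/n)$, and for $\alpha,\lambda\in\{1,\dots,n\}$ let $b_{\alpha,\lambda}\in\mathbb{C}^n$ be the time-frequency shift of the Alltop sequence $(\omega_n^{k^3})_k$ with entries $$[b_{\alpha,\lambda}]_k=\frac{1}{\sqrt n}\,\omega_n^{(k+\alpha)^3+\lambda(k+\alpha)},\qquad 1\le k\le n.$$ Let $s$ and $m$ be non-negative integers with $m\ge C\,s\log(2n)$, and let $A$ be the random $m\times n$ matrix whose rows are chosen independently and uniformly at random (with replacement) among the $n^2$ vectors $\sqrt n\,b_{\alpha,\lambda}$. Then, with probability at least $1-e^{-\tilde c m}$, the matrix $A$ recovers all $s$-sparse vectors.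 (2) More generally, let $n\ge 1$ and let $\{b^{(l)}_1,\dots,b^{(l)}_n\}$, $1\le l\le n+1$, be a maximal set of mutually unbiased bases of $\mathbb{C}^n$, that is, $n+1$ orthonormal bases with $|\langle b^{(l)}_i,b^{(l')}_j\rangle|^2=1/n$ for all $i,j$ and all $l\ne l'$, of which the last one is the standard basis. Let $s$ and $m$ be non-negative integers with $m\ge C\,s\log(2n)$, and let $A$ be the random $m\times n$ matrix whose rows are chosen independently and uniformly at random (with replacement) among the $n^2$ vectors $\sqrt n\,b^{(l)}_i$, $1\le l,i\le n$. Then, with probability at least $1-e^{-\tilde c m}$, the matrix $A$ recovers all $s$-sparse vectors. -/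

import Mathlib

open MeasureTheory ProbabilityTheory

/-- Two orthonormal bases of `ℂⁿ` are mutually unbiased if `|⟨bᵢ, cⱼ⟩|² = 1 / n` for all
`i` and `j`. -/
def MutuallyUnbiased {n : ℕ}
    (b c : OrthonormalBasis (Fin n) ℂ (EuclideanSpace ℂ (Fin n))) : Prop :=
  ∀ i j : Fin n, ‖inner ℂ (b i) (c j)‖ ^ 2 = 1 / (n : ℝ)

/-- A maximal set of mutually unbiased bases of `ℂⁿ`: a family of `n + 1` orthonormal bases
any two of which are mutually unbiased. -/
def IsMaximalMUB {n : ℕ}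
    (B : Fin (n + 1) → OrthonormalBasis (Fin n) ℂ (EuclideanSpace ℂ (Fin n))) : Prop :=
  ∀ l l' : Fin (n + 1), l ≠ l' → MutuallyUnbiased (B l) (B l')

/-- The normalized time-frequency shift `b_{α, λ}` of the Alltop sequence `k ↦ ω ^ (k ^ 3)`,
with `ω = exp (2 π i / n)`. The pair `p` is `(α, λ)`. All exponents only matter modulo `n`, so
that the indices may run over `0, …, n - 1`. -/
noncomputable def alltopShift (n : ℕ) (p : Fin n × Fin n) : EuclideanSpace ℂ (Fin n) :=
  WithLp.toLp 2 fun k : Fin n =>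
    (1 / (Real.sqrt n : ℂ)) *
      Complex.exp (2 * Real.pi * Complex.I / n) ^
        (((k : ℕ) + (p.1 : ℕ)) ^ 3 + (p.2 : ℕ) * ((k : ℕ) + (p.1 : ℕ)))

/-- The `m × n` matrix whose `i`-th row is `v i`, rescaled by the factor `√n` (a unit vector
becomes a row of length `√n`). -/
noncomputable def measurementMatrix {m n : ℕ} (v : Fin m → EuclideanSpace ℂ (Fin n)) :
    Matrix (Fin m) (Fin n) ℂ :=
  Matrix.of fun i k => (Real.sqrt n : ℂ) * v i k

/-- The `ℓ₁`-norm on `ℂⁿ`. -/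
noncomputable def l1Norm {n : ℕ} (z : Fin n → ℂ) : ℝ := ∑ k, ‖z k‖

/-- A vector is `s`-sparse if it has at most `s` non-zero entries. -/
def IsSparse {n : ℕ} (s : ℕ) (x : Fin n → ℂ) : Prop :=
  {k : Fin n | x k ≠ 0}.ncard ≤ s

/-- `z` solves the program: minimize `‖z‖₁` over `z ∈ ℂⁿ` subject to `A z = y`. -/
def IsL1Minimizer {m n : ℕ} (A : Matrix (Fin m) (Fin n) ℂ) (y : Fin m → ℂ)
    (z : Fin n → ℂ) : Prop :=
  A.mulVec z = y ∧ ∀ w : Fin n → ℂ, A.mulVec w = y → l1Norm z ≤ l1Norm w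

/-- Uniform `s`-sparse recovery: every `s`-sparse `x ∈ ℂⁿ` is the unique solution of
`ℓ₁`-minimization with data `y = A x`. -/
def RecoversSparse {m n : ℕ} (s : ℕ) (A : Matrix (Fin m) (Fin n) ℂ) : Prop :=
  ∀ x : Fin n → ℂ, IsSparse s x →
    ∀ z : Fin n → ℂ, IsL1Minimizer A (A.mulVec x) z ↔ z = x

/-- `X 0, …, X (m - 1)` are independent random elements of the finite set `ι`, each of them
uniformly distributed. -/
def IsIIDUniform {Ω ι : Type*} [MeasurableSpace Ω] [MeasurableSpace ι] {m : ℕ}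
    (X : Fin m → Ω → ι) (P : Measure Ω) : Prop :=
  (∀ i, Measurable (X i)) ∧ iIndepFun X P ∧ ∀ i, P.map (X i) = uniformOn Set.univ

/-! If recovery fails, the kernel of `A` contains `z ≠ 0` with `‖z‖₁ ≤ 2 √s ‖z‖₂`
(`recoversSparse_of_kernel`). Maurey's method, applied to the indefinite form `‖A y‖² - (m/4) ‖y‖²`,
replaces `z` by a sum `y ≠ 0` of `33 s` vectors `iᵃ eⱼ` on which the form is still negative
(`exists_small_of_kernel`). At most `(4n)^(33 s)` vectors `y` arise, so a union bound suffices and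
no restricted isometry property is needed.

For fixed `y`, `‖A y‖²` is a sum of `m` i.i.d. nonnegative variables with mean `‖y‖²` and second
moment at most `2 ‖y‖⁴`, so its lower tail is exponentially small (`measure_sum_le_of_moments`). The
mean is Parseval in each basis. The second moment comes from Cauchy–Schwarz on rank-one projections,
which are orthogonal across unbiased bases once centred (`sum_norm_inner_pow_four_le`). The Alltop
shifts form such bases because their cross inner products are quadratic Gauss sums. -/

/-! ### Maurey's empirical method -/

/-- Bias–variance decomposition. The variance does not depend on `c`, and equality lets two such
identities be subtracted, as an indefinite form requires. -/
lemma sum_weight_norm_add_sq {ι E : Type*} [Fintype ι] [NormedAddCommGroup E]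
    [InnerProductSpace ℂ E] (w : ι → ℝ) (hw : ∑ i, w i = 1) (v : ι → E) (c : E) :
    ∑ i, w i * ‖c + v i‖ ^ 2 =
      ‖c + ∑ i, (w i : ℂ) • v i‖ ^ 2 + (∑ i, w i * ‖v i‖ ^ 2 - ‖∑ i, (w i : ℂ) • v i‖ ^ 2) := by
  have h : ∑ i, w i * RCLike.re (inner ℂ c (v i)) =
      RCLike.re (inner ℂ c (∑ i, (w i : ℂ) • v i)) := by
    rw [inner_sum, map_sum]
    refine Finset.sum_congr rfl fun i _ => ?_
    rw [inner_smul_right]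
    simp
  rw [norm_add_sq (𝕜 := ℂ), ← h]
  simp only [norm_add_sq (𝕜 := ℂ), mul_add, Finset.sum_add_distrib, ← Finset.sum_mul, hw]
  simp only [Finset.mul_sum, mul_left_comm]
  ring

lemma exists_le_weighted_sum {ι : Type*} [Fintype ι] (w f : ι → ℝ) (hw0 : ∀ i, 0 ≤ w i)
    (hw : ∑ i, w i = 1) : ∃ i, f i ≤ ∑ j, w j * f j := by
  by_contra! h
  have h1 : ∑ i, w i * (∑ j, w j * f j) = ∑ j, w j * f j := by
    rw [← Finset.sum_mul, hw, one_mul]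
  obtain ⟨i, hi⟩ : ∃ i, 0 < w i := by
    by_contra! h0
    have : ∑ i, w i ≤ 0 := Finset.sum_nonpos fun i _ => h0 i
    linarith
  have h2 : ∑ i, w i * (∑ j, w j * f j) < ∑ i, w i * f i :=
    Finset.sum_lt_sum (fun i _ => mul_le_mul_of_nonneg_left (h i).le (hw0 i))
      ⟨i, Finset.mem_univ i, mul_lt_mul_of_pos_left (h i) hi⟩
  linarith

/-- Maurey's empirical method for the (possibly indefinite) form `‖L x‖² - c ‖x‖²`: the copies of
the convex combination are replaced one at a time by its extreme points. -/
lemma exists_sum_quadratic_le {ι E F : Type*} [Fintype ι] [NormedAddCommGroup E]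
    [InnerProductSpace ℂ E] [NormedAddCommGroup F] [InnerProductSpace ℂ F] (L : E →ₗ[ℂ] F)
    (c : ℝ) (w : ι → ℝ) (hw0 : ∀ i, 0 ≤ w i) (hw : ∑ i, w i = 1) (v : ι → E) (z : E)
    (hz : ∑ i, (w i : ℂ) • v i = z) (k : ℕ) (u : E) :
    ∃ g : Fin k → ι,
      ‖L (u + ∑ j, v (g j))‖ ^ 2 - c * ‖u + ∑ j, v (g j)‖ ^ 2 ≤
        ‖L (u + (k : ℂ) • z)‖ ^ 2 - c * ‖u + (k : ℂ) • z‖ ^ 2 +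
          k * (∑ i, w i * (‖L (v i)‖ ^ 2 - c * ‖v i‖ ^ 2) - (‖L z‖ ^ 2 - c * ‖z‖ ^ 2)) := by
  induction k generalizing u with
  | zero => exact ⟨Fin.elim0, by simp⟩
  | succ k ih =>
    have hLz : ∑ i, (w i : ℂ) • L (v i) = L z := by simp [← hz]
    have h1 := sum_weight_norm_add_sq w hw v (u + (k : ℂ) • z)
    have h2 := sum_weight_norm_add_sq w hw (fun i => L (v i)) (L (u + (k : ℂ) • z))
    rw [hz] at h1
    rw [hLz] at h2
    -- Fix one extreme point while the other `k` copies stay at the mean `z`; the cost is one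
    -- variance term.
    obtain ⟨i, hi⟩ := exists_le_weighted_sum w
      (fun i => ‖L (u + (k : ℂ) • z) + L (v i)‖ ^ 2 - c * ‖u + (k : ℂ) • z + v i‖ ^ 2) hw0 hw
    obtain ⟨g, hg⟩ := ih (u + v i)
    refine ⟨Fin.cons i g, ?_⟩
    simp only [Fin.sum_univ_succ, Fin.cons_zero, Fin.cons_succ]
    rw [← add_assoc]
    refine hg.trans ?_
    simp only [mul_sub, Finset.sum_sub_distrib, mul_left_comm _ c, ← Finset.mul_sum] at hi ⊢
    rw [h1, h2, ← map_add, ← map_add] at hi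
    have e1 : u + (k : ℂ) • z + v i = u + v i + (k : ℂ) • z := by abel
    have e2 : u + (k : ℂ) • z + z = u + ((k + 1 : ℕ) : ℂ) • z := by
      push_cast; rw [add_smul, one_smul, add_assoc]
    rw [e1, e2] at hi
    push_cast at hi ⊢
    linarith

/-! ### The dictionary of vectors `iᵃ eⱼ` -/

/-- The vertices `iᵃ eⱼ` of the `ℓ₁`-ball used as a dictionary. -/
noncomputable def signedBasis {n : ℕ} (q : Fin n × Fin 4) : EuclideanSpace ℂ (Fin n) :=
  EuclideanSpace.single q.1 (Complex.I ^ (q.2 : ℕ))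

lemma norm_signedBasis {n : ℕ} (q : Fin n × Fin 4) : ‖signedBasis q‖ = 1 := by
  simp [signedBasis]

/-- Weights representing a vector as a combination of the `iᵃ eⱼ`. -/
noncomputable def signedWeight {n : ℕ} (z : Fin n → ℂ) (q : Fin n × Fin 4) : ℝ :=
  ![max (z q.1).re 0, max (z q.1).im 0, max (-(z q.1).re) 0, max (-(z q.1).im) 0] q.2

lemma signedWeight_nonneg {n : ℕ} (z : Fin n → ℂ) (q : Fin n × Fin 4) :
    0 ≤ signedWeight z q := by
  obtain ⟨j, a⟩ := q
  fin_cases a <;> simp [signedWeight]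

lemma max_zero_sub_max_neg_zero (x : ℝ) : max x 0 - max (-x) 0 = x := by
  rcases le_total x 0 with h | h <;> simp [h]

lemma max_zero_add_max_neg_zero (x : ℝ) : max x 0 + max (-x) 0 = |x| := by
  rcases le_total x 0 with h | h <;> simp [h, abs_of_nonneg, abs_of_nonpos]

lemma sum_signedWeight {n : ℕ} (z : Fin n → ℂ) :
    ∑ q, signedWeight z q = ∑ j, (|(z j).re| + |(z j).im|) := by
  rw [Fintype.sum_prod_type]
  refine Finset.sum_congr rfl fun j _ => ?_
  simp only [signedWeight, Fin.sum_univ_four]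
  simp only [Matrix.cons_val]
  rw [← max_zero_add_max_neg_zero, ← max_zero_add_max_neg_zero]
  ring

lemma sum_signedWeight_smul {n : ℕ} (z : EuclideanSpace ℂ (Fin n)) :
    ∑ q, (signedWeight z q : ℂ) • signedBasis q = z := by
  ext k
  rw [Fintype.sum_prod_type]
  simp only [WithLp.ofLp_sum, Finset.sum_apply, WithLp.ofLp_smul, Pi.smul_apply, signedBasis,
    PiLp.single_apply, smul_eq_mul, mul_ite, mul_zero]
  rw [Finset.sum_comm]
  simp only [Finset.sum_ite_eq, Finset.mem_univ, if_true]
  simp only [signedWeight, Fin.sum_univ_four]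
  simp only [Matrix.cons_val]
  have h1 := max_zero_sub_max_neg_zero (z k).re
  have h2 := max_zero_sub_max_neg_zero (z k).im
  apply Complex.ext
  · simp [pow_succ]; linarith
  · simp [pow_succ]; linarith

/-! ### Failure of recovery and kernel vectors -/

/-- The difference `h` between a competitor and `x` has at least half of its `ℓ₁`-mass on the
support of `x`; Cauchy–Schwarz there gives `‖h‖₁ ≤ 2 √s ‖h‖₂`. -/
lemma recoversSparse_of_kernel {m n s : ℕ} (A : Matrix (Fin m) (Fin n) ℂ)
    (hA : ∀ z : EuclideanSpace ℂ (Fin n), A.mulVec z = 0 →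
      l1Norm z ^ 2 ≤ 4 * s * ‖z‖ ^ 2 → z = 0) : RecoversSparse s A := by
  classical
  intro x hx
  have key : ∀ w : Fin n → ℂ, A.mulVec w = A.mulVec x → l1Norm w ≤ l1Norm x → w = x := by
    intro w hw hle
    set S : Finset (Fin n) := Finset.univ.filter fun k => x k ≠ 0 with hS
    have hcard : S.card ≤ s := by
      refine le_trans (le_of_eq ?_) hx
      rw [← Set.ncard_coe_finset]
      simp [hS]
    set h : Fin n → ℂ := w - x with hh
    have hker : A.mulVec h = 0 := by rw [hh, Matrix.mulVec_sub, hw, sub_self]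
    have hpt : ∀ k, ‖x k‖ + ‖h k‖ ≤ ‖w k‖ + 2 * (if k ∈ S then ‖h k‖ else 0) := by
      intro k
      by_cases hk : x k = 0
      · simp [hh, hk, hS]
      · have : ‖x k‖ ≤ ‖w k‖ + ‖h k‖ := by
          have := norm_sub_le (w k) (h k)
          simpa [hh] using this
        simp only [hS, Finset.mem_filter, Finset.mem_univ, true_and, ne_eq, hk, not_false_eq_true,
          if_true]
        linarith
    have hsum := Finset.sum_le_sum fun k (_ : k ∈ Finset.univ) => hpt k
    rw [Finset.sum_add_distrib, Finset.sum_add_distrib, ← Finset.mul_sum, Finset.sum_ite_mem,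
      Finset.univ_inter] at hsum
    have h1 : l1Norm h ≤ 2 * ∑ k ∈ S, ‖h k‖ := by
      simp only [l1Norm] at hle ⊢
      linarith
    have h2 : (∑ k ∈ S, ‖h k‖) ^ 2 ≤ s * ∑ k, ‖h k‖ ^ 2 := by
      calc (∑ k ∈ S, ‖h k‖) ^ 2 ≤ S.card * ∑ k ∈ S, ‖h k‖ ^ 2 := sq_sum_le_card_mul_sum_sq
        _ ≤ s * ∑ k, ‖h k‖ ^ 2 := by
          gcongr
          exact Finset.subset_univ S
    have h0 : 0 ≤ l1Norm h := Finset.sum_nonneg fun _ _ => norm_nonneg _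
    have h3 : WithLp.toLp 2 h = 0 := by
      refine hA (WithLp.toLp 2 h) hker ?_
      rw [EuclideanSpace.norm_sq_eq]
      change l1Norm h ^ 2 ≤ 4 * s * ∑ k, ‖h k‖ ^ 2
      calc l1Norm h ^ 2 ≤ (2 * ∑ k ∈ S, ‖h k‖) ^ 2 := by gcongr
        _ ≤ _ := by linarith
    have h4 : h = 0 := by simpa using h3
    exact sub_eq_zero.1 h4
  refine fun z => ⟨fun hz => key z hz.1 (hz.2 x rfl), ?_⟩
  rintro rfl
  refine ⟨rfl, fun w hw => ?_⟩
  by_contra! hlt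
  rw [key w hw hlt.le] at hlt
  exact lt_irrefl _ hlt

lemma abs_re_add_abs_im_le (z : ℂ) : (|z.re| + |z.im|) ≤ Real.sqrt 2 * ‖z‖ := by
  rw [← abs_of_nonneg (add_nonneg (abs_nonneg z.re) (abs_nonneg z.im))]
  refine Real.abs_le_sqrt ?_ |>.trans_eq (?_ : Real.sqrt (2 * ‖z‖ ^ 2) = _)
  · rw [← Complex.normSq_eq_norm_sq, Complex.normSq_apply]
    nlinarith [sq_nonneg (|z.re| - |z.im|), sq_abs z.re, sq_abs z.im]
  · rw [Real.sqrt_mul (by norm_num), Real.sqrt_sq (norm_nonneg _)]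

/-- A kernel vector dominated by `s` of its entries produces a sum of `33 s` vectors `iᵃ eⱼ` on
which the matrix is far from being bounded below. -/
lemma exists_small_of_kernel {m n s : ℕ} (hm : 0 < m) (A : Matrix (Fin m) (Fin n) ℂ)
    (hA : ∀ i j, ‖A i j‖ = 1) (z : EuclideanSpace ℂ (Fin n)) (hz : A.mulVec z = 0)
    (hz1 : l1Norm z ^ 2 ≤ 4 * s * ‖z‖ ^ 2) (hz0 : z ≠ 0) :
    ∃ g : Fin (33 * s) → Fin n × Fin 4, ∑ j, signedBasis (g j) ≠ 0 ∧
      ∑ i, ‖A.mulVec (∑ j, signedBasis (g j) : EuclideanSpace ℂ (Fin n)) i‖ ^ 2 ≤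
        m / 4 * ‖∑ j, signedBasis (g j)‖ ^ 2 := by
  set σ : ℝ := ∑ j, (|(z j).re| + |(z j).im|) with hσ
  have hzpos : 0 < ‖z‖ := norm_pos_iff.2 hz0
  -- Using only four phases costs a factor `√2` in the `ℓ₁`-norm, turning `4 s` into `8 s` below.
  have hσle : σ ≤ Real.sqrt 2 * l1Norm z := by
    rw [l1Norm, Finset.mul_sum]
    exact Finset.sum_le_sum fun j _ => abs_re_add_abs_im_le (z j)
  have hw : ∑ q, signedWeight z q = σ := sum_signedWeight _
  have hrep := sum_signedWeight_smul z
  have hzle : ‖z‖ ≤ σ := by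
    calc ‖z‖ = ‖∑ q, (signedWeight z q : ℂ) • signedBasis q‖ := by rw [hrep]
      _ ≤ ∑ q, ‖(signedWeight z q : ℂ) • signedBasis q‖ := norm_sum_le _ _
      _ = σ := by
        rw [← hw]
        refine Finset.sum_congr rfl fun q _ => ?_
        rw [norm_smul, norm_signedBasis, mul_one, Complex.norm_real, Real.norm_eq_abs,
          abs_of_nonneg (signedWeight_nonneg _ _)]
  have hσpos : 0 < σ := hzpos.trans_le hzle
  have hσsq : σ ^ 2 ≤ 8 * s * ‖z‖ ^ 2 := by
    calc σ ^ 2 ≤ (Real.sqrt 2 * l1Norm z) ^ 2 := by gcongr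
      _ = 2 * l1Norm z ^ 2 := by rw [mul_pow, Real.sq_sqrt (by norm_num)]
      _ ≤ _ := by linarith
  have hL : ∀ x, ‖A.toEuclideanLin x‖ ^ 2 = ∑ i, ‖A.mulVec x i‖ ^ 2 := fun x => by
    rw [EuclideanSpace.norm_sq_eq]; rfl
  have hLv : ∀ q : Fin n × Fin 4, ‖A.toEuclideanLin (signedBasis q)‖ ^ 2 = m := by
    intro q
    rw [hL]
    simp [signedBasis, hA]
  set z' : EuclideanSpace ℂ (Fin n) := ((σ⁻¹ : ℝ) : ℂ) • z with hz'
  have hLz : A.toEuclideanLin z' = 0 := by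
    have : A.toEuclideanLin z = 0 := by
      ext i
      exact congrFun hz i
    rw [hz', map_smul, this, smul_zero]
  obtain ⟨g, hg⟩ := exists_sum_quadratic_le A.toEuclideanLin (m / 4 : ℝ)
    (fun q => σ⁻¹ * signedWeight z q)
    (fun q => mul_nonneg (inv_nonneg.2 hσpos.le) (signedWeight_nonneg _ _))
    (by rw [← Finset.mul_sum, hw, inv_mul_cancel₀ hσpos.ne'])
    signedBasis z' (by
      rw [hz', ← hrep, Finset.smul_sum]
      refine Finset.sum_congr rfl fun q _ => ?_
      rw [hrep, smul_smul]
      push_cast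
      rfl) (33 * s) 0
  have hwsum : ∑ q, σ⁻¹ * signedWeight z q * ((m : ℝ) - m / 4 * 1 ^ 2) = 3 * (m : ℝ) / 4 := by
    rw [← Finset.sum_mul, ← Finset.mul_sum, hw, inv_mul_cancel₀ hσpos.ne']
    ring
  simp only [zero_add, map_smul, hLz, smul_zero, norm_zero, hLv, norm_signedBasis, hwsum,
    norm_smul, hL] at hg
  have hnz : ‖z'‖ = σ⁻¹ * ‖z‖ := by
    rw [hz', norm_smul, Complex.norm_real, Real.norm_eq_abs, abs_of_pos (inv_pos.2 hσpos)]
  have ht1 : ‖z'‖ ^ 2 ≤ 1 := by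
    have : ‖z'‖ ≤ 1 := by rw [hnz, inv_mul_le_iff₀ hσpos, mul_one]; exact hzle
    exact pow_le_one₀ (norm_nonneg _) this
  have ht2 : 1 ≤ 8 * s * ‖z'‖ ^ 2 := by
    rw [hnz, mul_pow, inv_pow]
    have h2 : 0 < σ ^ 2 := by positivity
    calc (1 : ℝ) = (σ ^ 2)⁻¹ * σ ^ 2 := (inv_mul_cancel₀ h2.ne').symm
      _ ≤ (σ ^ 2)⁻¹ * (8 * s * ‖z‖ ^ 2) := by gcongr
      _ = _ := by ring
  have hs : (0 : ℝ) < s := by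
    rcases Nat.eq_zero_or_pos s with rfl | h
    · norm_num at ht2
    · exact_mod_cast h
  have hm' : (0 : ℝ) < m := by exact_mod_cast hm
  obtain ⟨t, hzt⟩ : ∃ t, ‖z'‖ ^ 2 = t := ⟨_, rfl⟩
  rw [hzt] at ht1 ht2
  have hneg : ∑ i, ‖A.mulVec (∑ j, signedBasis (g j) : EuclideanSpace ℂ (Fin n)) i‖ ^ 2 -
      (m : ℝ) / 4 * ‖∑ j, signedBasis (g j)‖ ^ 2 < 0 := by
    refine hg.trans_lt ?_
    push_cast
    simp only [Complex.norm_mul, Complex.norm_natCast, Complex.norm_ofNat, mul_pow, hzt]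
    -- Since `t ≤ 1` and `8 s t ≥ 1`, `33 s t ≥ 33/8 > 4 ≥ 3 + t`: this is why `33 s` terms are
    -- taken.
    have : 0 < (m : ℝ) * s := by positivity
    have e : (0 : ℝ) ^ 2 - m / 4 * (33 ^ 2 * s ^ 2 * t) +
        33 * s * (3 * m / 4 - (0 ^ 2 - m / 4 * t)) =
        (m * s) * (33 / 4) * (3 + t - 33 * (s * t)) := by ring
    rw [e]
    exact mul_neg_of_pos_of_neg (by positivity) (by linarith)
  -- Strict negativity also rules out a zero sum, where the form vanishes.
  refine ⟨g, fun h0 => ?_, by linarith⟩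
  rw [h0] at hneg
  simp at hneg

/-! ### Lower tail from two moments -/

lemma Real.exp_neg_le_one_sub_add_sq {t : ℝ} (ht : 0 ≤ t) :
    Real.exp (-t) ≤ 1 - t + t ^ 2 / 2 := by
  have h := Real.quadratic_le_exp_of_nonneg ht
  have h1 : 0 < 1 + t + t ^ 2 / 2 := by positivity
  rw [Real.exp_neg]
  calc (Real.exp t)⁻¹ ≤ (1 + t + t ^ 2 / 2)⁻¹ := inv_anti₀ h1 h
    _ ≤ _ := by
      rw [inv_le_iff_one_le_mul₀ h1]
      nlinarith [sq_nonneg (t ^ 2)]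

lemma integral_comp_of_map_eq_uniformOn {Ω ι : Type*} [MeasurableSpace Ω] [Fintype ι]
    [MeasurableSpace ι] [DiscreteMeasurableSpace ι] {P : Measure Ω} {X : Ω → ι}
    (hX : Measurable X) (h : P.map X = uniformOn Set.univ) (f : ι → ℝ) :
    ∫ ω, f (X ω) ∂P = (Fintype.card ι : ℝ)⁻¹ * ∑ i, f i := by
  rw [← integral_map (f := f) hX.aemeasurable
    (measurable_of_finite f).aestronglyMeasurable, h]
  rcases isEmpty_or_nonempty ι with hι | hι
  · simp [Measure.eq_zero_of_isEmpty]
  rw [integral_fintype (.of_finite), Finset.mul_sum]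
  refine Finset.sum_congr rfl fun i _ => ?_
  rw [smul_eq_mul, measureReal_def, uniformOn_univ]
  simp

/-- Lower tail of a sum of independent nonnegative variables with bounded kurtosis. -/
lemma measure_sum_le_of_moments {Ω ι : Type*} [MeasurableSpace Ω] [Fintype ι] [Nonempty ι]
    [MeasurableSpace ι] [DiscreteMeasurableSpace ι] {P : Measure Ω} [IsProbabilityMeasure P]
    {m : ℕ} {X : Fin m → Ω → ι} (hX : IsIIDUniform X P) (W : ι → ℝ) (hW : ∀ i, 0 ≤ W i)
    {r : ℝ} (hr : 0 < r) (h1 : ∑ i, W i = Fintype.card ι * r)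
    (h2 : ∑ i, W i ^ 2 ≤ Fintype.card ι * (2 * r ^ 2)) :
    P.real {ω | ∑ i, W (X i ω) ≤ m / 4 * r} ≤ Real.exp (-(m / 8)) := by
  obtain ⟨hmeas, hind, hmap⟩ := hX
  have hN : (0 : ℝ) < Fintype.card ι := by exact_mod_cast Fintype.card_pos
  -- This `t` gives each factor at most `1 - 1/2 + 1/4 = 3/4 ≤ exp (-1/4)`, against a Chernoff
  -- prefactor `exp (m/8)`.
  set t : ℝ := -(1 / (2 * r)) with ht
  have hmgf : ∀ i, mgf (fun ω => W (X i ω)) P t ≤ Real.exp (-(1 / 4)) := by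
    intro i
    rw [mgf, integral_comp_of_map_eq_uniformOn (hmeas i) (hmap i) fun j => Real.exp (t * W j)]
    have hb : ∀ j, Real.exp (t * W j) ≤ 1 - W j / (2 * r) + W j ^ 2 / (8 * r ^ 2) := by
      intro j
      have := Real.exp_neg_le_one_sub_add_sq (t := W j / (2 * r))
        (div_nonneg (hW j) (by positivity))
      convert this using 1
      · rw [ht]; congr 1; ring
      · field_simp; ring
    calc (Fintype.card ι : ℝ)⁻¹ * ∑ j, Real.exp (t * W j)
        ≤ (Fintype.card ι : ℝ)⁻¹ * ∑ j, (1 - W j / (2 * r) + W j ^ 2 / (8 * r ^ 2)) := by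
          gcongr with j; exact hb j
      _ = (Fintype.card ι : ℝ)⁻¹ *
          (Fintype.card ι - (∑ j, W j) / (2 * r) + (∑ j, W j ^ 2) / (8 * r ^ 2)) := by
          rw [Finset.sum_add_distrib, Finset.sum_sub_distrib, Finset.sum_div, Finset.sum_div]
          simp
      _ ≤ (Fintype.card ι : ℝ)⁻¹ * (Fintype.card ι - (Fintype.card ι * r) / (2 * r) +
          (Fintype.card ι * (2 * r ^ 2)) / (8 * r ^ 2)) := by
          rw [h1]; gcongr
      _ = -(1 / 4) + 1 := by field_simp; norm_num
      _ ≤ _ := Real.add_one_le_exp _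
  have hint : Integrable (fun ω => Real.exp (t * ∑ i, W (X i ω))) P := by
    refine Integrable.of_bound (C := 1) ?_ (.of_forall fun ω => ?_)
    · have : Measurable fun ω => ∑ i, W (X i ω) :=
        Finset.measurable_sum _ fun i _ => (measurable_of_finite W).comp (hmeas i)
      exact (this.const_mul t).exp.aestronglyMeasurable
    · rw [Real.norm_eq_abs, abs_of_pos (Real.exp_pos _), Real.exp_le_one_iff]
      exact mul_nonpos_of_nonpos_of_nonneg (by rw [ht, neg_nonpos]; positivity)
        (Finset.sum_nonneg fun i _ => hW _)
  have hc := measure_le_le_exp_mul_mgf (m / 4 * r) (by rw [ht, neg_nonpos]; positivity : t ≤ 0)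
    hint
  have hprod : mgf (fun ω => ∑ i, W (X i ω)) P t ≤ Real.exp (-(1 / 4)) ^ m := by
    have hind' : iIndepFun (fun i ω => W (X i ω)) P :=
      hind.comp (fun _ => W) fun _ => measurable_of_finite W
    have := hind'.mgf_sum (t := t) (fun i => (measurable_of_finite W).comp (hmeas i)) Finset.univ
    rw [show (fun ω => ∑ i, W (X i ω)) = ∑ i, fun ω => W (X i ω) by ext; simp, this]
    calc ∏ i, mgf (fun ω => W (X i ω)) P t ≤ ∏ _i : Fin m, Real.exp (-(1 / 4)) :=
          Finset.prod_le_prod (fun i _ => mgf_nonneg) fun i _ => hmgf i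
      _ = _ := by simp
  refine hc.trans ?_
  calc _ ≤ Real.exp (-t * (m / 4 * r)) * Real.exp (-(1 / 4)) ^ m := by gcongr
    _ = Real.exp (-(m / 8)) := by
      rw [← Real.exp_nat_mul, ← Real.exp_add, ht]
      congr 1
      field_simp
      ring

/-! ### Union bound over the dictionary sums -/

/-- Uniform sparse recovery for random rows with unimodular entries that are isotropic and have
bounded kurtosis. -/
theorem recoversSparse_of_moments {n : ℕ} (hn : 1 ≤ n) {Ω ι : Type*} [MeasurableSpace Ω]
    [Fintype ι] [Nonempty ι] [MeasurableSpace ι] [DiscreteMeasurableSpace ι] {P : Measure Ω}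
    [IsProbabilityMeasure P] {s m : ℕ} {X : Fin m → Ω → ι} (hX : IsIIDUniform X P)
    (hsm : 1056 * s * Real.log (2 * n) ≤ m) (v : ι → EuclideanSpace ℂ (Fin n))
    (hv : ∀ p k, ‖(Real.sqrt n : ℂ) * v p k‖ = 1)
    (h1 : ∀ y : EuclideanSpace ℂ (Fin n),
      ∑ p, ‖∑ k, (Real.sqrt n : ℂ) * v p k * y k‖ ^ 2 = Fintype.card ι * ‖y‖ ^ 2)
    (h2 : ∀ y : EuclideanSpace ℂ (Fin n),
      ∑ p, (‖∑ k, (Real.sqrt n : ℂ) * v p k * y k‖ ^ 2) ^ 2 ≤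
        Fintype.card ι * (2 * (‖y‖ ^ 2) ^ 2)) :
    1 - Real.exp (-(1 / 16) * m) ≤
      P.real {ω | RecoversSparse s (measurementMatrix fun i => v (X i ω))} := by
  rcases Nat.eq_zero_or_pos m with rfl | hm
  · simp
  set good : Set Ω := {ω | RecoversSparse s (measurementMatrix fun i => v (X i ω))} with hgood
  let y (g : Fin (33 * s) → Fin n × Fin 4) : EuclideanSpace ℂ (Fin n) := ∑ j, signedBasis (g j)
  let bad (g : Fin (33 * s) → Fin n × Fin 4) : Set Ω :=
    {ω | y g ≠ 0 ∧ ∑ i, ‖∑ k, (Real.sqrt n : ℂ) * v (X i ω) k * y g k‖ ^ 2 ≤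
      m / 4 * ‖y g‖ ^ 2}
  have hsub : goodᶜ ⊆ ⋃ g, bad g := by
    intro ω hω
    by_contra hbad
    refine hω (recoversSparse_of_kernel _ fun z hz hz1 => ?_)
    by_contra hz0
    obtain ⟨g, hg0, hg⟩ := exists_small_of_kernel hm
      (measurementMatrix fun i => v (X i ω)) (fun i k => hv (X i ω) k) z hz hz1 hz0
    exact hbad (Set.mem_iUnion.2 ⟨g, hg0, hg⟩)
  have hbad : ∀ g, P.real (bad g) ≤ Real.exp (-(m / 8)) := by
    intro g
    by_cases hy : y g = 0
    · have : bad g = ∅ := by ext ω; simp [bad, hy]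
      rw [this, measureReal_empty]
      exact (Real.exp_pos _).le
    · have hr : 0 < ‖y g‖ ^ 2 := by have := norm_pos_iff.2 hy; positivity
      refine le_trans (measureReal_mono fun ω hω => hω.2)
        (measure_sum_le_of_moments hX
          (fun p => ‖∑ k, (Real.sqrt n : ℂ) * v p k * y g k‖ ^ 2) (fun _ => by positivity) hr
          (h1 _) (h2 _))
  have hunion : P.real goodᶜ ≤ Real.exp (-(1 / 16) * m) := by
    have hn' : (1 : ℝ) ≤ n := by exact_mod_cast hn
    calc P.real goodᶜ ≤ P.real (⋃ g, bad g) := measureReal_mono hsub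
      _ ≤ ∑ g, P.real (bad g) := measureReal_iUnion_fintype_le _
      _ ≤ ∑ _g : Fin (33 * s) → Fin n × Fin 4, Real.exp (-(m / 8)) :=
        Finset.sum_le_sum fun g _ => hbad g
      _ = ((n : ℝ) * 4) ^ (33 * s) * Real.exp (-(m / 8)) := by simp
      _ ≤ ((2 * n : ℝ) ^ 2) ^ (33 * s) * Real.exp (-(m / 8)) := by
        gcongr
        nlinarith
      _ = Real.exp (66 * s * Real.log (2 * n) - m / 8) := by
        rw [← pow_mul, sub_eq_add_neg, Real.exp_add]
        congr 1
        rw [← Real.exp_log (by positivity : (0 : ℝ) < 2 * n), ← Real.exp_nat_mul, Real.log_exp]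
        push_cast
        ring_nf
      -- `1056 = 16 · 66`: the entropy term uses at most `m/16` of the exponent `m/8`.
      _ ≤ _ := by
        gcongr
        linarith
  have hcover : 1 ≤ P.real good + P.real goodᶜ := by
    have := measureReal_union_le (μ := P) good goodᶜ
    rwa [Set.union_compl_self, probReal_univ] at this
  linarith

/-! ### Fourth moments of mutually unbiased bases -/

/-- The tensor `v ⊗ v̄`, i.e. the rank-one projection of `v` as a vector. -/
noncomputable def rankOne {n : ℕ} (v : EuclideanSpace ℂ (Fin n)) :
    EuclideanSpace ℂ (Fin n × Fin n) :=
  WithLp.toLp 2 fun p => v p.1 * star (v p.2)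

lemma inner_rankOne {n : ℕ} (u v : EuclideanSpace ℂ (Fin n)) :
    inner ℂ (rankOne u) (rankOne v) = ((‖inner ℂ u v‖ ^ 2 : ℝ) : ℂ) := by
  have : ((‖inner ℂ u v‖ ^ 2 : ℝ) : ℂ) = inner ℂ u v * star (inner ℂ u v) := by
    rw [← Complex.normSq_eq_norm_sq, Complex.normSq_eq_conj_mul_self, mul_comm]; rfl
  rw [this, PiLp.inner_apply, PiLp.inner_apply, star_sum, Finset.sum_mul_sum,
    Fintype.sum_prod_type]
  refine Finset.sum_congr rfl fun j _ => Finset.sum_congr rfl fun k _ => ?_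
  simp [rankOne]
  ring

lemma norm_rankOne {n : ℕ} (v : EuclideanSpace ℂ (Fin n)) : ‖rankOne v‖ = ‖v‖ ^ 2 := by
  have h := inner_rankOne v v
  rw [inner_self_eq_norm_sq_to_K, inner_self_eq_norm_sq_to_K] at h
  have h' : ‖rankOne v‖ ^ 2 = (‖v‖ ^ 2) ^ 2 := by
    simp at h
    exact_mod_cast h
  exact (sq_eq_sq₀ (norm_nonneg _) (by positivity)).1 h'

/-- Bessel's inequality for a family of mutually unbiased bases. -/
lemma sum_norm_inner_pow_four_le {n : ℕ} (hn : 1 ≤ n)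
    (B : Fin n → OrthonormalBasis (Fin n) ℂ (EuclideanSpace ℂ (Fin n)))
    (hB : ∀ l l', l ≠ l' → MutuallyUnbiased (B l) (B l')) (z : EuclideanSpace ℂ (Fin n)) :
    ∑ l, ∑ i, (‖inner ℂ z (B l i)‖ ^ 2) ^ 2 ≤ 2 * (‖z‖ ^ 2) ^ 2 := by
  have hn' : (n : ℝ) ≠ 0 := by positivity
  set r := ‖z‖ ^ 2 with hr
  let c (p : Fin n × Fin n) : ℝ := ‖inner ℂ z (B p.1 p.2)‖ ^ 2
  -- Centring makes the coefficients sum to zero in each basis, which kills the constant cross-basis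
  -- Gram entries `1/n`.
  let x (p : Fin n × Fin n) : ℝ := c p - r / n
  have hc : ∀ l, ∑ i, c (l, i) = r := fun l => (B l).sum_sq_norm_inner_left z
  have hx : ∀ l, ∑ i, x (l, i) = 0 := fun l => by
    simp only [x, Finset.sum_sub_distrib, hc]
    simp
    field_simp
    simp
  have hxc : ∑ p, x p * c p = ∑ p, x p ^ 2 := by
    have : ∑ p, x p * (r / n) = 0 := by
      rw [← Finset.sum_mul, Fintype.sum_prod_type]; simp [hx]
    rw [← sub_eq_zero, ← Finset.sum_sub_distrib, ← this]
    refine Finset.sum_congr rfl fun p _ => ?_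
    simp only [x]; ring
  have hgram : ∀ p q : Fin n × Fin n, ‖inner ℂ (B p.1 p.2) (B q.1 q.2)‖ ^ 2 =
      (if p = q then (1 : ℝ) else 0) + (if p.1 = q.1 then 0 else (1 / n : ℝ)) := by
    rintro ⟨l, i⟩ ⟨l', j⟩
    by_cases h : l = l'
    · subst h
      have := orthonormal_iff_ite.1 (B l).orthonormal i j
      rw [this]
      by_cases hij : i = j <;> simp [hij]
    · simpa [h] using hB l l' h i j
  let T : EuclideanSpace ℂ (Fin n × Fin n) := ∑ p, (x p : ℂ) • rankOne (B p.1 p.2)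
  have hT : ‖T‖ ^ 2 = ∑ p, x p ^ 2 := by
    have e : (inner ℂ T T : ℂ) = ((∑ p, ∑ q, x p * (x q *
        ‖inner ℂ (B p.1 p.2) (B q.1 q.2)‖ ^ 2) : ℝ) : ℂ) := by
      simp only [T, sum_inner, inner_sum, inner_smul_left, inner_smul_right, inner_rankOne]
      push_cast
      rw [Finset.sum_comm]
      refine Finset.sum_congr rfl fun p _ => ?_
      rw [Finset.mul_sum]
      refine Finset.sum_congr rfl fun q _ => ?_
      rw [Complex.conj_ofReal]
      ring
    rw [inner_self_eq_norm_sq_to_K] at e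
    have e' : ‖T‖ ^ 2 = ∑ p, ∑ q, x p * (x q *
        ‖inner ℂ (B p.1 p.2) (B q.1 q.2)‖ ^ 2) :=
      Complex.ofReal_injective ((Complex.ofReal_pow _ _).trans e)
    rw [e']
    refine Finset.sum_congr rfl fun p _ => ?_
    rw [← Finset.mul_sum, sq]
    congr 1
    simp only [hgram, mul_add, Finset.sum_add_distrib]
    have : ∑ q : Fin n × Fin n, x q * (if p.1 = q.1 then 0 else (1 / n : ℝ)) = 0 := by
      rw [Fintype.sum_prod_type]
      refine Finset.sum_eq_zero fun l _ => ?_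
      change ∑ i, x (l, i) * (if p.1 = l then 0 else (1 / n : ℝ)) = 0
      rw [← Finset.sum_mul, hx, zero_mul]
    rw [this]
    simp
  have hTz : (inner ℂ (rankOne z) T : ℂ) = ((∑ p, x p ^ 2 : ℝ) : ℂ) := by
    simp only [T, inner_sum, inner_smul_right, inner_rankOne]
    rw [← hxc]
    simp only [c]
    push_cast
    rfl
  -- `S` equals both `‖T‖²` and the pairing of `T` with `rankOne z`, so Cauchy–Schwarz reads `S² ≤
  -- r² S`.
  have hS : ∑ p, x p ^ 2 ≤ r ^ 2 := by
    set S := ∑ p, x p ^ 2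
    have hS0 : 0 ≤ S := Finset.sum_nonneg fun _ _ => sq_nonneg _
    have h : ‖(inner ℂ (rankOne z) T : ℂ)‖ ≤ ‖rankOne z‖ * ‖T‖ := norm_inner_le_norm _ _
    rw [hTz, Complex.norm_real, Real.norm_eq_abs, abs_of_nonneg hS0, norm_rankOne] at h
    have h' : S * S ≤ r ^ 2 * S := by
      calc S * S = S ^ 2 := (sq S).symm
        _ ≤ (‖z‖ ^ 2 * ‖T‖) ^ 2 := by gcongr
        _ = r ^ 2 * S := by rw [mul_pow, hT]
    rcases hS0.eq_or_lt with h0 | h0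
    · rw [← h0]; positivity
    · exact le_of_mul_le_mul_right h' h0
  have hsum : ∑ p, c p ^ 2 = ∑ p, x p ^ 2 + r ^ 2 := by
    have h1 : ∀ p, c p ^ 2 = x p ^ 2 + (2 * (r / n) * c p - (r / n) ^ 2) := fun p => by
      simp only [x]; ring
    simp only [h1, Finset.sum_add_distrib, Finset.sum_sub_distrib, ← Finset.mul_sum]
    rw [Fintype.sum_prod_type (f := c)]
    simp only [hc]
    simp
    field_simp
    ring
  calc ∑ l, ∑ i, (‖inner ℂ z (B l i)‖ ^ 2) ^ 2 = ∑ p, c p ^ 2 := by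
        rw [Fintype.sum_prod_type]
    _ ≤ _ := by rw [hsum]; linarith

theorem recoversSparse_of_mutuallyUnbiased {n : ℕ} (hn : 1 ≤ n)
    (B : Fin n → OrthonormalBasis (Fin n) ℂ (EuclideanSpace ℂ (Fin n)))
    (hB : ∀ l l', l ≠ l' → MutuallyUnbiased (B l) (B l'))
    (hB1 : ∀ l i k, ‖B l i k‖ ^ 2 = 1 / (n : ℝ)) {s m : ℕ}
    (hsm : 1056 * s * Real.log (2 * n) ≤ m) {Ω : Type*} [MeasurableSpace Ω] {P : Measure Ω}
    [IsProbabilityMeasure P] {X : Fin m → Ω → Fin n × Fin n} (hX : IsIIDUniform X P) :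
    1 - Real.exp (-(1 / 16) * m) ≤
      P.real {ω | RecoversSparse s (measurementMatrix fun i => B (X i ω).1 (X i ω).2)} := by
  have hn' : (n : ℝ) ≠ 0 := by positivity
  have : Nonempty (Fin n) := ⟨⟨0, hn⟩⟩
  -- Matrix rows act bilinearly, so `y` is conjugated to express the products as inner products.
  let conj (y : EuclideanSpace ℂ (Fin n)) : EuclideanSpace ℂ (Fin n) :=
    WithLp.toLp 2 fun k => star (y k)
  have hconj : ∀ y, ‖conj y‖ ^ 2 = ‖y‖ ^ 2 := fun y => by
    simp [conj, EuclideanSpace.norm_sq_eq]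
  have hsum : ∀ (u y : EuclideanSpace ℂ (Fin n)),
      ‖∑ k, (Real.sqrt n : ℂ) * u k * y k‖ ^ 2 = n * ‖inner ℂ (conj y) u‖ ^ 2 := by
    intro u y
    have : ∑ k, (Real.sqrt n : ℂ) * u k * y k = Real.sqrt n * inner ℂ (conj y) u := by
      rw [PiLp.inner_apply, Finset.mul_sum]
      refine Finset.sum_congr rfl fun k _ => ?_
      simp [conj, mul_assoc]
    rw [this, norm_mul, mul_pow, Complex.norm_real, Real.norm_eq_abs, sq_abs,
      Real.sq_sqrt (Nat.cast_nonneg n)]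
  refine recoversSparse_of_moments hn hX hsm (fun p => B p.1 p.2) (fun p k => ?_) (fun y => ?_)
    fun y => ?_
  · have : ‖(Real.sqrt n : ℂ) * B p.1 p.2 k‖ ^ 2 = 1 := by
      rw [norm_mul, mul_pow, Complex.norm_real, Real.norm_eq_abs, sq_abs,
        Real.sq_sqrt (Nat.cast_nonneg n), hB1, mul_one_div_cancel hn']
    exact (pow_eq_one_iff_of_nonneg (norm_nonneg _) two_ne_zero).1 this
  · simp only [hsum, ← Finset.mul_sum]
    rw [Fintype.sum_prod_type]
    simp only [OrthonormalBasis.sum_sq_norm_inner_left, hconj]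
    simp
    ring
  · simp only [hsum, mul_pow (n : ℝ), ← Finset.mul_sum]
    rw [Fintype.sum_prod_type]
    have := sum_norm_inner_pow_four_le hn B hB (conj y)
    rw [hconj] at this
    calc (n : ℝ) ^ 2 * ∑ l, ∑ i, (‖inner ℂ (conj y) (B l i)‖ ^ 2) ^ 2
        ≤ (n : ℝ) ^ 2 * (2 * (‖y‖ ^ 2) ^ 2) := by gcongr
      _ = _ := by rw [Fintype.card_prod, Fintype.card_fin]; push_cast; ring

/-! ### Gauss sums and the Alltop bases -/

lemma ZMod.norm_stdAddChar {n : ℕ} [NeZero n] (x : ZMod n) : ‖ZMod.stdAddChar x‖ = 1 := by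
  rw [ZMod.stdAddChar_apply, Circle.norm_coe]

lemma ZMod.conj_stdAddChar {n : ℕ} [NeZero n] (x : ZMod n) :
    (starRingEnd ℂ) (ZMod.stdAddChar x) = ZMod.stdAddChar (-x) :=
  (AddChar.map_neg_eq_conj _ _).symm

lemma ZMod.stdAddChar_natCast {n : ℕ} [NeZero n] (N : ℕ) :
    ZMod.stdAddChar (N : ZMod n) = Complex.exp (2 * Real.pi * Complex.I / n) ^ N := by
  have := ZMod.stdAddChar_coe (N := n) (N : ℤ)
  rw [Int.cast_natCast] at this
  rw [this, ← Complex.exp_nat_mul]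
  congr 1
  push_cast
  ring

/-- The modulus of a quadratic Gauss sum. -/
lemma ZMod.norm_sum_stdAddChar_quadratic {n : ℕ} [NeZero n] (hp : n.Prime) (h2 : n ≠ 2)
    {a : ZMod n} (ha : a ≠ 0) (b c : ZMod n) :
    ‖∑ x : ZMod n, ZMod.stdAddChar (a * x ^ 2 + b * x + c)‖ ^ 2 = n := by
  have := Fact.mk hp
  have htwo : (2 : ZMod n) ≠ 0 := by
    intro h
    have h' : ((2 : ℕ) : ZMod n) = 0 := by exact_mod_cast h
    rw [ZMod.natCast_eq_zero_iff] at h'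
    exact h2 ((Nat.prime_dvd_prime_iff_eq hp Nat.prime_two).1 h')
  set S := ∑ x : ZMod n, ZMod.stdAddChar (a * x ^ 2 + b * x + c) with hS
  have key : S * (starRingEnd ℂ) S = n := by
    calc S * (starRingEnd ℂ) S
        = ∑ y : ZMod n, ∑ h : ZMod n, ZMod.stdAddChar (a * (h + y) ^ 2 + b * (h + y) + c) *
            ZMod.stdAddChar (-(a * y ^ 2 + b * y + c)) := by
          rw [hS, map_sum, Finset.mul_sum]
          refine Finset.sum_congr rfl fun y _ => ?_
          rw [ZMod.conj_stdAddChar, Finset.sum_mul]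
          exact (Equiv.sum_comp (Equiv.addRight y) fun x =>
            ZMod.stdAddChar (a * x ^ 2 + b * x + c) *
              ZMod.stdAddChar (-(a * y ^ 2 + b * y + c))).symm
      -- After `x = h + y` the exponent is linear in `y`, so only `h = 0` survives.
      _ = ∑ h : ZMod n, ZMod.stdAddChar (a * h ^ 2 + b * h) *
            ∑ y : ZMod n, ZMod.stdAddChar (y * (2 * a * h)) := by
          rw [Finset.sum_comm]
          refine Finset.sum_congr rfl fun h _ => ?_
          rw [Finset.mul_sum]
          refine Finset.sum_congr rfl fun y _ => ?_
          rw [← AddChar.map_add_eq_mul, ← AddChar.map_add_eq_mul]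
          congr 1
          ring
      _ = n := by
          simp only [AddChar.sum_mulShift _ (ZMod.isPrimitive_stdAddChar n), mul_eq_zero, htwo, ha,
            false_or]
          simp
  rw [Complex.mul_conj] at key
  rw [← Complex.normSq_eq_norm_sq]
  exact_mod_cast key

lemma natCast_fin_injective {n : ℕ} {i j : Fin n} (h : ((i : ℕ) : ZMod n) = ((j : ℕ) : ZMod n)) :
    i = j := by
  rw [ZMod.natCast_eq_natCast_iff', Nat.mod_eq_of_lt i.2, Nat.mod_eq_of_lt j.2] at h
  exact Fin.ext h

lemma sum_fin_natCast {n : ℕ} [NeZero n] (f : ZMod n → ℂ) :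
    ∑ k : Fin n, f ((k : ℕ) : ZMod n) = ∑ x, f x := by
  have hinj : Function.Injective fun k : Fin n => ((k : ℕ) : ZMod n) :=
    fun _ _ h => natCast_fin_injective h
  have hbij := (Fintype.bijective_iff_injective_and_card _).2 ⟨hinj, by simp [ZMod.card]⟩
  exact hbij.sum_comp f

lemma alltopShift_apply {n : ℕ} [NeZero n] (p : Fin n × Fin n) (k : Fin n) :
    alltopShift n p k = (1 / (Real.sqrt n : ℂ)) *
      ZMod.stdAddChar ((((k : ℕ) : ZMod n) + ((p.1 : ℕ) : ZMod n)) ^ 3 +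
        ((p.2 : ℕ) : ZMod n) * (((k : ℕ) : ZMod n) + ((p.1 : ℕ) : ZMod n))) := by
  change (1 / (Real.sqrt n : ℂ)) * Complex.exp (2 * Real.pi * Complex.I / n) ^
    (((k : ℕ) + (p.1 : ℕ)) ^ 3 + (p.2 : ℕ) * ((k : ℕ) + (p.1 : ℕ))) = _
  rw [← ZMod.stdAddChar_natCast]
  push_cast
  rfl

lemma inner_alltopShift {n : ℕ} [NeZero n] (p q : Fin n × Fin n) :
    inner ℂ (alltopShift n p) (alltopShift n q) = (1 / n : ℂ) *
      ∑ x : ZMod n, ZMod.stdAddChar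
        ((x + ((q.1 : ℕ) : ZMod n)) ^ 3 + ((q.2 : ℕ) : ZMod n) * (x + ((q.1 : ℕ) : ZMod n)) -
          ((x + ((p.1 : ℕ) : ZMod n)) ^ 3 + ((p.2 : ℕ) : ZMod n) * (x + ((p.1 : ℕ) : ZMod n)))) := by
  have hsqrt : (1 / (Real.sqrt n : ℂ)) * (1 / (Real.sqrt n : ℂ)) = 1 / n := by
    rw [div_mul_div_comm, one_mul, ← Complex.ofReal_mul, Real.mul_self_sqrt (Nat.cast_nonneg n)]
    simp
  rw [← sum_fin_natCast, PiLp.inner_apply, Finset.mul_sum]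
  refine Finset.sum_congr rfl fun k _ => ?_
  rw [alltopShift_apply, alltopShift_apply, RCLike.inner_apply, map_mul, map_div₀, map_one,
    Complex.conj_ofReal, ZMod.conj_stdAddChar, ← hsqrt, mul_mul_mul_comm,
    ← AddChar.map_add_eq_mul, ← sub_eq_add_neg]

lemma norm_sq_alltopShift_apply {n : ℕ} [NeZero n] (p : Fin n × Fin n) (k : Fin n) :
    ‖alltopShift n p k‖ ^ 2 = 1 / (n : ℝ) := by
  rw [alltopShift_apply, norm_mul, ZMod.norm_stdAddChar, mul_one, norm_div, norm_one,
    Complex.norm_real, div_pow, Real.norm_eq_abs, sq_abs, Real.sq_sqrt (Nat.cast_nonneg n), one_pow]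

/-- For equal time shifts the cubic phases cancel entirely, leaving orthogonality of additive
characters. -/
lemma orthonormal_alltopShift {n : ℕ} [NeZero n] (α : Fin n) :
    Orthonormal ℂ fun i => alltopShift n (α, i) := by
  have hn : (n : ℂ) ≠ 0 := Nat.cast_ne_zero.2 (NeZero.ne n)
  rw [orthonormal_iff_ite]
  intro i j
  rw [inner_alltopShift]
  have : ∑ x : ZMod n, ZMod.stdAddChar
      ((x + ((α : ℕ) : ZMod n)) ^ 3 + ((j : ℕ) : ZMod n) * (x + ((α : ℕ) : ZMod n)) -
        ((x + ((α : ℕ) : ZMod n)) ^ 3 + ((i : ℕ) : ZMod n) * (x + ((α : ℕ) : ZMod n)))) =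
      ∑ x : ZMod n, ZMod.stdAddChar (x * (((j : ℕ) : ZMod n) - ((i : ℕ) : ZMod n))) := by
    rw [← Equiv.sum_comp (Equiv.addRight ((α : ℕ) : ZMod n))
      fun x => ZMod.stdAddChar (x * (((j : ℕ) : ZMod n) - ((i : ℕ) : ZMod n)))]
    refine Finset.sum_congr rfl fun x _ => ?_
    congr 1
    simp only [Equiv.coe_addRight]
    ring
  rw [this, AddChar.sum_mulShift _ (ZMod.isPrimitive_stdAddChar n)]
  by_cases hij : i = j
  · simp [hij, ZMod.card, hn]
  · rw [if_neg hij, if_neg fun h => hij (natCast_fin_injective (sub_eq_zero.1 h)).symm]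
    simp

/-- The time shifts of the Alltop sequence index the bases; the frequency shifts index the
elements of each of them. -/
noncomputable def alltopBasis {n : ℕ} [NeZero n] (α : Fin n) :
    OrthonormalBasis (Fin n) ℂ (EuclideanSpace ℂ (Fin n)) :=
  (basisOfOrthonormalOfCardEqFinrank (orthonormal_alltopShift α) (by simp)).toOrthonormalBasis
    (by rw [coe_basisOfOrthonormalOfCardEqFinrank]; exact orthonormal_alltopShift α)

lemma alltopBasis_apply {n : ℕ} [NeZero n] (α i : Fin n) :
    alltopBasis α i = alltopShift n (α, i) := by
  simp [alltopBasis]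

lemma mutuallyUnbiased_alltopBasis {n : ℕ} [NeZero n] (hp : n.Prime) (hn : 5 ≤ n) {α β : Fin n}
    (h : α ≠ β) : MutuallyUnbiased (alltopBasis α) (alltopBasis β) := by
  have := Fact.mk hp
  intro i j
  have hthree : (3 : ZMod n) ≠ 0 := by
    intro h
    have h' : ((3 : ℕ) : ZMod n) = 0 := by exact_mod_cast h
    rw [ZMod.natCast_eq_zero_iff, Nat.prime_dvd_prime_iff_eq hp Nat.prime_three] at h'
    omega
  obtain ⟨a, ha⟩ : ∃ a, a = ((α : ℕ) : ZMod n) := ⟨_, rfl⟩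
  obtain ⟨b, hb⟩ : ∃ b, b = ((β : ℕ) : ZMod n) := ⟨_, rfl⟩
  have hab : b - a ≠ 0 := fun h0 =>
    h (natCast_fin_injective (ha ▸ hb ▸ sub_eq_zero.1 h0)).symm
  rw [alltopBasis_apply, alltopBasis_apply, inner_alltopShift, norm_mul, mul_pow]
  -- Only the `x³` terms cancel. The leading coefficient `3 (b - a)` is nonzero because `n ≥ 5` is
  -- prime.
  have e : ∀ x : ZMod n, (x + b) ^ 3 + ((j : ℕ) : ZMod n) * (x + b) -
      ((x + a) ^ 3 + ((i : ℕ) : ZMod n) * (x + a)) =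
      (3 * (b - a)) * x ^ 2 + (3 * (b ^ 2 - a ^ 2) + (((j : ℕ) : ZMod n) - ((i : ℕ) : ZMod n))) * x +
        (b ^ 3 - a ^ 3 + (((j : ℕ) : ZMod n) * b - ((i : ℕ) : ZMod n) * a)) := fun x => by ring
  simp only [← ha, ← hb, e]
  rw [ZMod.norm_sum_stdAddChar_quadratic hp (by omega) (mul_ne_zero hthree hab)]
  have hn0 : (n : ℝ) ≠ 0 := by positivity
  simp
  field_simp

/-! ### The two random ensembles -/

theorem theorem2 :
    ∃ C : ℝ, 0 < C ∧ ∃ c : ℝ, 0 < c ∧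
      -- random time-frequency shifts of the Alltop sequence
      (∀ n : ℕ, 5 ≤ n → n.Prime →
        ∀ s m : ℕ, C * s * Real.log (2 * n) ≤ m →
          ∀ (Ω : Type*) [MeasurableSpace Ω] (P : Measure Ω) [IsProbabilityMeasure P]
            (X : Fin m → Ω → Fin n × Fin n), IsIIDUniform X P →
            1 - Real.exp (-c * m) ≤
              P.real {ω | RecoversSparse s
                (measurementMatrix fun i => alltopShift n (X i ω))}) ∧
      -- random elements of a maximal set of mutually unbiased bases, without the standard basis
      (∀ n : ℕ, 1 ≤ n →
        ∀ B : Fin (n + 1) → OrthonormalBasis (Fin n) ℂ (EuclideanSpace ℂ (Fin n)),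
          IsMaximalMUB B → B (Fin.last n) = EuclideanSpace.basisFun (Fin n) ℂ →
        ∀ s m : ℕ, C * s * Real.log (2 * n) ≤ m →
          ∀ (Ω : Type*) [MeasurableSpace Ω] (P : Measure Ω) [IsProbabilityMeasure P]
            (X : Fin m → Ω → Fin n × Fin n), IsIIDUniform X P →
            1 - Real.exp (-c * m) ≤
              P.real {ω | RecoversSparse s
                (measurementMatrix fun i => B (X i ω).1.castSucc (X i ω).2)}) := by
  refine ⟨1056, by norm_num, 1 / 16, by norm_num, ?_, ?_⟩
  · intro n hn hp s m hsm Ω _ P _ X hX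
    have : NeZero n := ⟨by omega⟩
    have h := recoversSparse_of_mutuallyUnbiased (by omega) alltopBasis
      (fun α β hαβ => mutuallyUnbiased_alltopBasis hp hn hαβ)
      (fun α i k => by rw [alltopBasis_apply, norm_sq_alltopShift_apply]) hsm hX
    simpa only [alltopBasis_apply] using h
  · intro n hn B hB hlast s m hsm Ω _ P _ X hX
    refine recoversSparse_of_mutuallyUnbiased hn (fun l => B l.castSucc)
      (fun l l' h => hB _ _ fun h' => h (Fin.castSucc_injective n h')) (fun l i k => ?_) hsm hX
    -- Unbiasedness to the standard basis says exactly that every entry has squared modulus `1/n`.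
    have h := hB (Fin.last n) l.castSucc (Fin.castSucc_lt_last l).ne' k i
    rw [hlast, EuclideanSpace.basisFun_apply, EuclideanSpace.inner_single_left] at h
    simpa using h
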